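/- Let $\mathcal{C}$ be a small category with finite limits, $J$ a Grothendieck topology on $\mathcal{C}$, and $\mathcal{E}=\mathbf{Sh}(\mathcal{C},J)$. An internal locale in $\mathcal{E}$ is a $J$-sheaf $L:\mathcal{C}^{op}\to\mathbf{Set}$ such that every $L(c)$ is a frame, every transition map $L(f):L(c)\to L(d)$ (for $f:d\to c$) is a frame homomorphism with a left adjoint $\exists_f\dashv L(f)$, and the following hold: (Beck--Chevalley) for every pullback square in $\mathcal{C}$ formed by $f:a\to b$, $g:a\to c$, $e:b\to d$, $h:c\to d$ with $ef=hg$, one has $\exists_g L(f)=L(h)\exists_e$; (Frobenius) $\exists_f(L(f)(l')\wedge l)=\exists_f(l)\wedge l'$ for all $f:d\to c$, $l\in L(d)$, $l'\in L(c)$. Let $\mathcal{G}(L)$ be the category whose objects are the pairs $(c,x)$ with $x\in L(c)$ and whose morphisms $(d,y)\to(c,x)$ are the morphisms $f:d\to c$ of $\mathcal{C}$ with $y\leq L(f)(x)$. Let $J^{ext}$ be the existential topology on $\mathcal{G}(L)$: a sieve on $(c,x)$ is covering if and only if it contains a family $\{f_i:(c_i,x_i)\to(c,x)\mid i\in I\}$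 with $\bigvee_{i\in I}\exists_{f_i}(x_i)=x$. A Heyting algebra is a Stone algebra if it satisfies De Morgan's law $\neg(x\wedge y)\leq\neg x\vee\neg y$, and a topos is De Morgan if its subobject classifier is an internal Stone algebra. **Proposition.** Let $L$ be an internal locale in $\mathcal{E}$. Then the topos $\mathbf{Sh}(\mathcal{G}(L),J^{ext})$ is De Morgan if and only if $L$ is pointwise a Stone algebra, that is, $L(c)$ is a Stone algebra for every object $c$ of $\mathcal{C}$. -/

import Mathlib

open CategoryTheory CategoryTheory.Limits Opposite

universe u v

/-- A Heyting algebra is a Stone algebra (or De Morgan algebra) if it satisfies De Morgan's law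
`¬ (x ∧ y) ≤ ¬ x ∨ ¬ y`. -/
def IsStoneAlgebra (H : Type*) [HeytingAlgebra H] : Prop :=
  ∀ x y : H, (x ⊓ y)ᶜ ≤ xᶜ ⊔ yᶜ

/-! ### The internal Heyting operations of a subobject classifier -/

namespace SubobjectClassifier

section Operations

variable {E : Type u} [Category.{v} E] [HasFiniteLimits E] [HasInitial E] [InitialMonoClass E]
  (W : Subobject.Classifier E)

/-- Internal conjunction `Ω × Ω ⟶ Ω`, the characteristic morphism of `(⊤, ⊤) : 1 ⟶ Ω × Ω`. -/
noncomputable def conj : W.Ω ⨯ W.Ω ⟶ W.Ω :=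
  W.χ (prod.lift W.truth W.truth)

/-- The truth value "false" `⊥ : 1 ⟶ Ω`, the characteristic morphism of `0 ⟶ 1`. -/
noncomputable def falsity : W.Ω₀ ⟶ W.Ω :=
  W.χ (initial.to W.Ω₀)

instance mono_falsity : Mono (falsity W) :=
  Subobject.Classifier.isTerminalΩ₀.mono_from _

/-- Internal negation `Ω ⟶ Ω`, the characteristic morphism of `⊥ : 1 ⟶ Ω`. -/
noncomputable def neg : W.Ω ⟶ W.Ω :=
  W.χ (falsity W)

/-- Internal disjunction `Ω × Ω ⟶ Ω`, the characteristic morphism of the union of the two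
subobjects `{(p, q) | p = ⊤}` and `{(p, q) | q = ⊤}` of `Ω × Ω`. -/
noncomputable def disj [HasImages E] [HasBinaryCoproducts E] : W.Ω ⨯ W.Ω ⟶ W.Ω :=
  W.χ ((Subobject.pullback prod.fst).obj (Subobject.mk W.truth) ⊔
    (Subobject.pullback prod.snd).obj (Subobject.mk W.truth)).arrow

/-- The internal order of `Ω` on generalized elements: `p ≤ q` if and only if `p ∧ q = p`. -/
def Entails {X : E} (p q : X ⟶ W.Ω) : Prop :=
  prod.lift p q ≫ conj W = p

/-- The subobject classifier is an internal Stone algebra: the morphisms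
`(p, q) ↦ ¬ (p ∧ q)` and `(p, q) ↦ ¬ p ∨ ¬ q` from `Ω × Ω` to `Ω` satisfy
`¬ (p ∧ q) ≤ ¬ p ∨ ¬ q`. -/
def IsInternalStone [HasImages E] [HasBinaryCoproducts E] : Prop :=
  Entails W (conj W ≫ neg W) (prod.map (neg W) (neg W) ≫ disj W)

end Operations

end SubobjectClassifier

/-- A topos is De Morgan if its subobject classifier is an internal Stone algebra. Subobject
classifiers are unique up to a unique isomorphism, so that it does not matter which one is taken. -/
def IsDeMorganTopos (E : Type u) [Category.{v} E] [HasFiniteLimits E] [HasFiniteColimits E]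
    [HasImages E] [InitialMonoClass E] : Prop :=
  ∃ W : Subobject.Classifier E, SubobjectClassifier.IsInternalStone W

/-! ### Internal locales -/

/-- An internal locale in the topos `Sh(C, J)`: a `J`-sheaf `L` which is pointwise a frame, whose
transition maps are frame homomorphisms with a left adjoint `∃_f ⊣ L(f)`, and which satisfies the
Beck-Chevalley condition and Frobenius reciprocity. -/
structure InternalLocale {C : Type u} [SmallCategory C] (J : GrothendieckTopology C) where
  /-- the frames `L(c)` and the transition maps `L(f)` -/
  frm : Cᵒᵖ ⥤ Frm.{u}
  /-- the underlying presheaf of sets is a sheaf -/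
  isSheaf : Presheaf.IsSheaf J (frm ⋙ forget Frm.{u})
  /-- the left adjoints `∃_f` -/
  ex : ∀ {d c : C}, (d ⟶ c) → frm.obj (op d) → frm.obj (op c)
  gc : ∀ {d c : C} (f : d ⟶ c), GaloisConnection (ex f) (frm.map f.op)
  beckChevalley : ∀ {a b c d : C} {f : a ⟶ b} {g : a ⟶ c} {e : b ⟶ d} {h : c ⟶ d},
    IsPullback f g e h → ∀ x : frm.obj (op b), ex g (frm.map f.op x) = frm.map h.op (ex e x)
  frobenius : ∀ {d c : C} (f : d ⟶ c) (l : frm.obj (op d)) (l' : frm.obj (op c)),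
    ex f (frm.map f.op l' ⊓ l) = ex f l ⊓ l'

namespace InternalLocale

variable {C : Type u} [SmallCategory C] {J : GrothendieckTopology C} (L : InternalLocale J)

/-- An internal locale satisfies De Morgan's law if it is (pointwise) a Stone algebra. -/
def IsStone : Prop :=
  ∀ c : C, IsStoneAlgebra (L.frm.obj (op c))

/-- The objects `(c, x)`, with `x ∈ L(c)`, of the Grothendieck construction `G(L)`. -/
structure Total where
  base : C
  fib : L.frm.obj (op base)

/-- A morphism `(d, y) ⟶ (c, x)` of `G(L)` is a morphism `f : d ⟶ c` with `y ≤ L(f)(x)`. -/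
@[ext]
structure Total.Hom (Y X : L.Total) where
  base : Y.base ⟶ X.base
  le : Y.fib ≤ L.frm.map base.op X.fib

instance : SmallCategory L.Total where
  Hom Y X := Total.Hom L Y X
  id X := ⟨𝟙 X.base, by simp⟩
  comp {Z Y X} g f := ⟨g.base ≫ f.base, by
    rw [op_comp, Functor.map_comp]
    exact g.le.trans (OrderHomClass.mono (L.frm.map g.base.op).hom f.le)⟩
  id_comp f := Total.Hom.ext (Category.id_comp f.base)
  comp_id f := Total.Hom.ext (Category.comp_id f.base)
  assoc f g h := Total.Hom.ext (Category.assoc f.base g.base h.base)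

/-- A sieve `S` on `(c, x)` is existentially covering if it contains a family of morphisms
`f_i : (c_i, x_i) ⟶ (c, x)` with `⋁_i ∃_{f_i}(x_i) = x`. -/
def ExistentiallyCovers {X : L.Total} (S : Sieve X) : Prop :=
  ∃ (I : Type u) (Y : I → L.Total) (f : ∀ i, Y i ⟶ X),
    (∀ i, S (f i)) ∧ ⨆ i, L.ex (f i).base (Y i).fib = X.fib

variable {L}

theorem ex_le {Y X : L.Total} (f : Y ⟶ X) : L.ex f.base Y.fib ≤ X.fib :=
  (L.gc f.base).l_le (Total.Hom.le f)

theorem ex_comp {d c b : C} (f : d ⟶ c) (g : c ⟶ b) (x : L.frm.obj (op d)) :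
    L.ex (f ≫ g) x = L.ex g (L.ex f x) := by
  refine eq_of_forall_ge_iff fun z => ?_
  rw [(L.gc _).le_iff_le, (L.gc _).le_iff_le, (L.gc _).le_iff_le, op_comp, Functor.map_comp]
  rfl

/-- A sieve is existentially covering if and only if every upper bound of the elements
`∃_f(y)`, for the `f : (d, y) ⟶ (c, x)` in the sieve, lies above `x`. -/
theorem existentiallyCovers_iff {X : L.Total} (S : Sieve X) :
    L.ExistentiallyCovers S ↔ ∀ z : L.frm.obj (op X.base),
      (∀ ⦃Y : L.Total⦄ (f : Y ⟶ X), S f → L.ex f.base Y.fib ≤ z) → X.fib ≤ z := by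
  constructor
  · rintro ⟨I, Y, f, hf, h⟩ z hz
    rw [← h]
    exact iSup_le fun i => hz _ (hf i)
  · intro h
    refine ⟨Σ Y : L.Total, {f : Y ⟶ X // S f}, fun i => i.1, fun i => i.2.1,
      fun i => i.2.2, le_antisymm (iSup_le fun i => ex_le i.2.1) (h _ fun Y f hf => ?_)⟩
    exact le_iSup (fun i : Σ Y : L.Total, {f : Y ⟶ X // S f} => L.ex i.2.1.base i.1.fib)
      ⟨Y, f, hf⟩

variable (L)

/-- The existential topology on `G(L)`. -/
def existentialTopology [HasPullbacks C] : GrothendieckTopology L.Total where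
  sieves X := {S | L.ExistentiallyCovers S}
  top_mem' X := (existentiallyCovers_iff _).2 fun z hz => by
    refine (L.gc (𝟙 X.base)).le_u_l X.fib |>.trans ?_
    have h := hz (𝟙 X) trivial
    have h' : L.ex (𝟙 X.base) X.fib ≤ z := h
    simpa using h'
  pullback_stable' := by
    rintro X Y S h ⟨I, Z, f, hf, hS⟩
    refine (existentiallyCovers_iff _).2 fun z hz => ?_
    have key : ∀ i, L.frm.map h.base.op (L.ex (f i).base (Z i).fib) ⊓ Y.fib ≤ z := by
      intro i
      let p := pullback.fst (f i).base h.base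
      let q := pullback.snd (f i).base h.base
      let P : L.Total := ⟨pullback (f i).base h.base,
        L.frm.map q.op Y.fib ⊓ L.frm.map p.op (Z i).fib⟩
      let p' : P ⟶ Z i := ⟨p, inf_le_right⟩
      let q' : P ⟶ Y := ⟨q, inf_le_left⟩
      have e : q' ≫ h = p' ≫ f i :=
        Total.Hom.ext (pullback.condition (f := (f i).base) (g := h.base)).symm
      have hq : L.ex q P.fib ≤ z := hz q' (by
        rw [Sieve.pullback_apply, e]
        exact S.downward_closed (hf i) p')
      rw [← L.beckChevalley (IsPullback.of_hasPullback (f i).base h.base), ← L.frobenius]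
      exact hq
    have h1 : Y.fib ≤ L.frm.map h.base.op (⨆ i, L.ex (f i).base (Z i).fib) := by
      rw [hS]
      exact Total.Hom.le h
    have h2 : L.frm.map h.base.op (⨆ i, L.ex (f i).base (Z i).fib) =
        ⨆ i, L.frm.map h.base.op (L.ex (f i).base (Z i).fib) :=
      map_iSup (L.frm.map h.base.op).hom _
    rw [h2] at h1
    calc Y.fib = (⨆ i, L.frm.map h.base.op (L.ex (f i).base (Z i).fib)) ⊓ Y.fib :=
          (inf_eq_right.2 h1).symm
      _ = ⨆ i, L.frm.map h.base.op (L.ex (f i).base (Z i).fib) ⊓ Y.fib := iSup_inf_eq _ _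
      _ ≤ z := iSup_le key
  transitive' := by
    rintro X S ⟨I, Y, f, hf, hS⟩ R hR
    refine (existentiallyCovers_iff _).2 fun z hz => ?_
    rw [← hS]
    refine iSup_le fun i => ?_
    rw [(L.gc _).le_iff_le]
    refine (existentiallyCovers_iff _).1 (hR (hf i)) _ fun W g hg => ?_
    rw [← (L.gc _).le_iff_le, ← ex_comp]
    exact hz (g ≫ f i) hg

/-- The topos of internal sheaves `Sh(G(L), J^ext)` on the internal locale `L`. -/
abbrev InternalSheaves [HasPullbacks C] : Type (u + 1) :=
  Sheaf L.existentialTopology (Type u)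

end InternalLocale

/-!
The topos of sheaves on a site is De Morgan if and only if De Morgan's law holds for the truth
values over each object of the site, that is, for the closed sieves. For the existential topology
on `G(L)` the closed sieves on `(c, x)` are classified by the elements of `L(c)` below `x`: the
arrows `f : (d, y) ⟶ (c, x)` of a sieve cover `(c, z)`, where `z` is the supremum of the `∃_f(y)`,
so that a closed sieve is generated by `(c, z) ⟶ (c, x)` (`exists_below_eq`). Hence the topos is De
Morgan if and only if the frames of elements below each `x` in `L(c)` are Stone algebras, and this
amounts to each `L(c)` being one.

The first equivalence is obtained for an arbitrary subobject classifier `Ω`, by Kripke-Joyal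
semantics. A truth value over `X` is determined by the arrows along which it becomes true
(`section_ext`), and `isTrue_conj_iff`, `isTrue_neg_iff` and `isTrue_disj_iff` say when a
conjunction, a negation or a disjunction is true: negation refers to the objects covered by the
empty sieve, and disjunction holds locally, since a union of subsheaves is the sheafification of
the pointwise union (`mem_range_sup_arrow_iff`). Closed sieves are exactly the sieves of arrows
along which some truth value becomes true, and `isDeMorganTopos_sheaf_iff` follows.

In `G(L)` an object `(c, x)` is covered by the empty sieve if and only if `x = ⊥`. By Frobenius
reciprocity the pullback along `f : (d, y) ⟶ (c, x)` of the closed sieve given by `z` is empty, in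
this sense, if and only if `∃_f(y) ≤ ¬ z` (`forall_below_comp_imp_bot_mem_iff`). De Morgan's law for
closed sieves thus becomes: if `x ≤ ¬ (z ∧ w)`, then `x ≤ ¬ z ∨ ¬ w`.
-/

/-! ### Sections of limits of sheaves -/

namespace SubobjectClassifier

variable {D : Type u} [SmallCategory D] {J : GrothendieckTopology D}

/-- The functor `F ↦ F(X)` of sections over `X`. It preserves limits. -/
abbrev sectionsAt (X : Dᵒᵖ) : Sheaf J (Type u) ⥤ Type u :=
  sheafToPresheaf J (Type u) ⋙ (evaluation Dᵒᵖ (Type u)).obj X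

theorem isPullback_sections {F G H K : Sheaf J (Type u)} {a : F ⟶ G} {b : F ⟶ H} {c : G ⟶ K}
    {d : H ⟶ K} (h : IsPullback a b c d) (X : Dᵒᵖ) :
    IsPullback (a.hom.app X) (b.hom.app X) (c.hom.app X) (d.hom.app X) :=
  h.map (sectionsAt X)

theorem prod_sections_ext {F G : Sheaf J (Type u)} {X : Dᵒᵖ} {x y : (F ⨯ G).obj.obj X}
    (h₁ : (prod.fst : F ⨯ G ⟶ F).hom.app X x = (prod.fst : F ⨯ G ⟶ F).hom.app X y)
    (h₂ : (prod.snd : F ⨯ G ⟶ G).hom.app X x = (prod.snd : F ⨯ G ⟶ G).hom.app X y) : x = y :=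
  ((Types.isPullback_iff _ _ _ _).1
    (isPullback_sections (IsPullback.of_hasBinaryProduct' F G) X)).2.1 x y ⟨h₁, h₂⟩

theorem nonempty_unique_sections_of_isTerminal {F : Sheaf J (Type u)} (h : IsTerminal F) (X : Dᵒᵖ) :
    Nonempty (Unique (F.obj.obj X)) :=
  ⟨(Types.isTerminalEquivUnique _) (h.isTerminalObj (sectionsAt X) F)⟩

theorem exists_prod_sections {F G : Sheaf J (Type u)} {X : Dᵒᵖ} (x : F.obj.obj X)
    (y : G.obj.obj X) : ∃ z : (F ⨯ G).obj.obj X,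
      (prod.fst : F ⨯ G ⟶ F).hom.app X z = x ∧ (prod.snd : F ⨯ G ⟶ G).hom.app X z = y := by
  refine ((Types.isPullback_iff _ _ _ _).1
    (isPullback_sections (IsPullback.of_hasBinaryProduct' F G) X)).2.2 x y ?_
  obtain ⟨h⟩ := nonempty_unique_sections_of_isTerminal (J := J) terminalIsTerminal X
  exact Subsingleton.elim _ _

/-! ### Truth values and closed sieves -/

-- Instance searches are slow in categories of sheaves; the next three instances shorten them.
local instance hasFiniteColimits_sheaf : HasFiniteColimits (Sheaf J (Type u)) :=
  inferInstance

local instance hasInitial_sheaf : HasInitial (Sheaf J (Type u)) :=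
  HasFiniteColimits.out (Discrete PEmpty)

local instance hasBinaryCoproducts_sheaf : HasBinaryCoproducts (Sheaf J (Type u)) :=
  HasFiniteColimits.out (Discrete WalkingPair)

variable (W : Subobject.Classifier (Sheaf J (Type u)))

/-- The section `a` of `Ω` over `X` is the truth value "true", that is, it lies in the image of
`truth : 1 ⟶ Ω`. -/
def IsTrue {X : Dᵒᵖ} (a : W.Ω.obj.obj X) : Prop :=
  a ∈ Set.range (W.truth.hom.app X)

variable {W}

theorem isTrue_iff_exists_of_isPullback {F G : Sheaf J (Type u)} {m : F ⟶ G} {t : F ⟶ W.Ω₀}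
    {p : G ⟶ W.Ω} (h : IsPullback m t p W.truth) {X : Dᵒᵖ} (s : G.obj.obj X) :
    IsTrue W (p.hom.app X s) ↔ s ∈ Set.range (m.hom.app X) := by
  have := (Types.isPullback_iff _ _ _ _).1 (isPullback_sections h X)
  constructor
  · rintro ⟨a, ha⟩
    obtain ⟨b, hb, -⟩ := this.2.2 s a ha.symm
    exact ⟨b, hb⟩
  · rintro ⟨b, rfl⟩
    exact ⟨t.hom.app X b, (ConcreteCategory.congr_hom this.1 b).symm⟩

theorem isTrue_χ_iff {F G : Sheaf J (Type u)} (m : F ⟶ G) [Mono m] {X : Dᵒᵖ} (s : G.obj.obj X) :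
    IsTrue W ((W.χ m).hom.app X s) ↔ s ∈ Set.range (m.hom.app X) :=
  isTrue_iff_exists_of_isPullback (W.isPullback m) s

/-- In the classifier given by closed sieves, "true" is the maximal sieve. -/
theorem isTrue_classifier_iff {X : Dᵒᵖ} (S : (Sheaf.Ω J).obj.obj X) :
    IsTrue (Sheaf.classifier J) S ↔ S.1 = (⊤ : Sieve X.unop) := by
  constructor
  · rintro ⟨a, rfl⟩
    rfl
  · intro h
    exact ⟨PUnit.unit, Subtype.ext h.symm⟩

/-- The comparison between two subobject classifiers preserves and reflects truth. -/
theorem isTrue_hom_iff (W' : Subobject.Classifier (Sheaf J (Type u))) {X : Dᵒᵖ}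
    (a : W.Ω.obj.obj X) : IsTrue W' ((W.hom W').hom.app X a) ↔ IsTrue W a :=
  isTrue_χ_iff W.truth a

variable (W) in
/-- The sieve of the arrows along which a section of `Ω` becomes true. It is defined as the image of
the section under the comparison with the classifier of closed sieves; `truthSieve_apply` gives the
description in terms of arrows. -/
noncomputable def truthSieve {X : D} (a : W.Ω.obj.obj (op X)) : Sieve X :=
  ((W.hom (Sheaf.classifier J)).hom.app (op X) a).1

theorem isClosed_truthSieve {X : D} (a : W.Ω.obj.obj (op X)) : J.IsClosed (truthSieve W a) :=
  ((W.hom (Sheaf.classifier J)).hom.app (op X) a).2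

theorem isTrue_iff_truthSieve_eq_top {X : D} (a : W.Ω.obj.obj (op X)) :
    IsTrue W a ↔ truthSieve W a = ⊤ :=
  (isTrue_hom_iff (Sheaf.classifier J) a).symm.trans (isTrue_classifier_iff _)

/-- Over an object covered by the empty sieve every truth value is true. -/
theorem isTrue_of_bot_mem {X : D} (h : (⊥ : Sieve X) ∈ J X) (a : W.Ω.obj.obj (op X)) :
    IsTrue W a :=
  (isTrue_iff_truthSieve_eq_top a).2 <| top_unique fun _ g _ =>
    isClosed_truthSieve a g (J.superset_covering bot_le (J.pullback_stable g h))

theorem truthSieve_apply {X Y : D} (a : W.Ω.obj.obj (op X)) (f : Y ⟶ X) :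
    truthSieve W a f ↔ IsTrue W (W.Ω.obj.map f.op a) := by
  rw [← isTrue_hom_iff (Sheaf.classifier J), NatTrans.naturality_apply]
  have h := isTrue_classifier_iff
    ((Sheaf.Ω J).obj.map f.op ((W.hom (Sheaf.classifier J)).hom.app (op X) a))
  exact (Sieve.mem_iff_pullback_eq_top f).trans h.symm

theorem exists_truthSieve_eq {X : D} {S : Sieve X} (hS : J.IsClosed S) :
    ∃ a : W.Ω.obj.obj (op X), truthSieve W a = S := by
  refine ⟨((Sheaf.classifier J).hom W).hom.app (op X) ⟨S, hS⟩, ?_⟩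
  have := congr_arg (fun k => k.hom.app (op X) ⟨S, hS⟩)
    ((Sheaf.classifier J).hom_comp_hom W (Sheaf.classifier J))
  rw [Subobject.Classifier.hom_refl] at this
  exact congr_arg Subtype.val this

/-- Extensionality for sections of `Ω`: a truth value is determined by the arrows along which it
becomes true. -/
theorem section_ext {X : D} {a b : W.Ω.obj.obj (op X)}
    (h : ∀ ⦃Y : D⦄ (f : Y ⟶ X), IsTrue W (W.Ω.obj.map f.op a) ↔ IsTrue W (W.Ω.obj.map f.op b)) :
    a = b := by
  have inj : Function.Injective ((W.hom (Sheaf.classifier J)).hom.app (op X)) := by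
    rw [← mono_iff_injective]
    exact inferInstanceAs (Mono ((sectionsAt (op X)).map (W.hom (Sheaf.classifier J))))
  refine inj (Subtype.ext (Sieve.ext fun Y f => ?_))
  exact (truthSieve_apply a f).trans ((h f).trans (truthSieve_apply b f).symm)

theorem hom_ext_of_isTrue {F : Sheaf J (Type u)} {p q : F ⟶ W.Ω}
    (h : ∀ ⦃X : Dᵒᵖ⦄ (s : F.obj.obj X), IsTrue W (p.hom.app X s) ↔ IsTrue W (q.hom.app X s)) :
    p = q := by
  ext ⟨X⟩ s
  refine section_ext fun Y f => ?_
  change IsTrue W (W.Ω.obj.map f.op (p.hom.app (op X) s)) ↔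
    IsTrue W (W.Ω.obj.map f.op (q.hom.app (op X) s))
  rw [← NatTrans.naturality_apply, ← NatTrans.naturality_apply]
  exact h _

/-! ### Forcing conditions for the internal operations -/

theorem isTrue_conj_iff {X : Dᵒᵖ} (x : (W.Ω ⨯ W.Ω).obj.obj X) :
    IsTrue W ((conj W).hom.app X x) ↔
      IsTrue W ((prod.fst : W.Ω ⨯ W.Ω ⟶ W.Ω).hom.app X x) ∧
      IsTrue W ((prod.snd : W.Ω ⨯ W.Ω ⟶ W.Ω).hom.app X x) := by
  have h₁ := fun t => ConcreteCategory.congr_hom (congr_app (congr_arg (·.hom)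
    (prod.lift_fst W.truth W.truth)) X) t
  have h₂ := fun t => ConcreteCategory.congr_hom (congr_app (congr_arg (·.hom)
    (prod.lift_snd W.truth W.truth)) X) t
  refine (isTrue_χ_iff _ x).trans ?_
  constructor
  · rintro ⟨t, rfl⟩
    exact ⟨⟨t, (h₁ t).symm⟩, ⟨t, (h₂ t).symm⟩⟩
  · rintro ⟨⟨t, ht⟩, ⟨t', ht'⟩⟩
    obtain ⟨h⟩ := nonempty_unique_sections_of_isTerminal W.isTerminalΩ₀ X
    obtain rfl : t = t' := Subsingleton.elim _ _
    exact ⟨t, prod_sections_ext ((h₁ t).trans ht) ((h₂ t).trans ht')⟩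

/-- The initial sheaf has a section over `X` exactly when the empty sieve covers `X`. -/
theorem nonempty_initial_sections_iff {X : D} :
    Nonempty ((⊥_ (Sheaf J (Type u))).obj.obj (op X)) ↔ (⊥ : Sieve X) ∈ J X := by
  constructor
  · rintro ⟨x⟩
    -- The two constant maps to the sheaf of closed sieves, with values the maximal and the least
    -- closed sieve, agree on the initial sheaf.
    let t : (⊥_ (Sheaf J (Type u))) ⟶ Sheaf.Ω J :=
      ⟨{ app := fun Y => ↾fun _ => ⟨(⊤ : Sieve Y.unop), fun _ _ _ => trivial⟩
         naturality := fun Y Z f => by ext s; exact Subtype.ext (Sieve.pullback_top).symm }⟩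
    let b : (⊥_ (Sheaf J (Type u))) ⟶ Sheaf.Ω J :=
      ⟨{ app := fun Y => ↾fun _ => ⟨J.close (⊥ : Sieve Y.unop), J.close_isClosed _⟩
         naturality := fun Y Z f => by
          ext s
          refine Subtype.ext ?_
          change J.close ⊥ = (J.close ⊥).pullback f.unop
          rw [← J.pullback_close]
          congr 1 }⟩
    have h : b = t := initialIsInitial.hom_ext _ _
    have e : b.hom.app (op X) x = t.hom.app (op X) x := by rw [h]
    exact (J.close_eq_top_iff_mem _).1 (congr_arg Subtype.val e)
  · intro h
    obtain ⟨x, -, -⟩ := (isSheaf_iff_isSheaf_of_type J _).1 (⊥_ (Sheaf J (Type u))).property _ h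
      (fun _ _ hf => False.elim hf) (by intro _ _ _ _ _ _ _ hf; exact False.elim hf)
    exact ⟨x⟩

theorem isTrue_falsity_iff {X : D} (t : W.Ω₀.obj.obj (op X)) :
    IsTrue W ((falsity W).hom.app (op X) t) ↔ (⊥ : Sieve X) ∈ J X := by
  refine (isTrue_χ_iff _ t).trans (Iff.trans ?_ nonempty_initial_sections_iff)
  obtain ⟨h⟩ := nonempty_unique_sections_of_isTerminal W.isTerminalΩ₀ (op X)
  exact ⟨fun ⟨x, _⟩ => ⟨x⟩, fun ⟨x⟩ => ⟨x, Subsingleton.elim _ _⟩⟩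

/-- A negation is true if and only if the term becomes true only over objects covered by the empty
sieve. -/
theorem isTrue_neg_iff {X : D} (a : W.Ω.obj.obj (op X)) :
    IsTrue W ((neg W).hom.app (op X) a) ↔
      ∀ ⦃Y : D⦄ (f : Y ⟶ X), IsTrue W (W.Ω.obj.map f.op a) → (⊥ : Sieve Y) ∈ J Y := by
  refine (isTrue_χ_iff _ a).trans ?_
  constructor
  · rintro ⟨t, rfl⟩ Y f h
    rw [← NatTrans.naturality_apply] at h
    exact (isTrue_falsity_iff _).1 h
  · intro h
    -- `a` and "false" become true along the same arrows: those from objects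
    -- covered by the empty sieve.
    obtain ⟨_⟩ := nonempty_unique_sections_of_isTerminal W.isTerminalΩ₀ (op X)
    refine ⟨default, section_ext fun Y f => ?_⟩
    rw [← NatTrans.naturality_apply, isTrue_falsity_iff]
    exact ⟨fun hY => isTrue_of_bot_mem hY _, h f⟩

/-- The sections of a union of subsheaves are those which lie locally in one of the two. -/
theorem mem_range_sup_arrow_iff {F : Sheaf J (Type u)} (A B : Subobject F) {X : D}
    (s : F.obj.obj (op X)) :
    s ∈ Set.range ((A ⊔ B).arrow.hom.app (op X)) ↔
      (Subfunctor.range A.arrow.hom ⊔ Subfunctor.range B.arrow.hom).sieveOfSection s ∈ J X := by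
  have hF := (isSheaf_iff_isSheaf_of_type J _).1 F.property
  constructor
  · intro hs
    -- The sheafification of the pointwise union is a subsheaf which contains both `A` and `B`.
    let G := (Subfunctor.range A.arrow.hom ⊔ Subfunctor.range B.arrow.hom).sheafify J
    let G' : Sheaf J (Type u) :=
      ⟨G.toFunctor, (isSheaf_iff_isSheaf_of_type J _).2 (Subfunctor.sheafify_isSheaf _ hF)⟩
    let i : G' ⟶ F := ⟨G.ι⟩
    have : Mono i := (sheafToPresheaf J _).mono_of_mono_map (inferInstanceAs (Mono G.ι))
    have key : ∀ K : Subobject F, Subfunctor.range K.arrow.hom ≤ G → K ≤ Subobject.mk i := by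
      intro K hK
      refine Subobject.le_mk_of_comm ⟨Subfunctor.lift (G := G) K.arrow.hom hK⟩ ?_
      ext1
      exact Subfunctor.lift_ι _ hK
    have hle : A ⊔ B ≤ Subobject.mk i := sup_le
      (key A (le_sup_left.trans (Subfunctor.le_sheafify J _)))
      (key B (le_sup_right.trans (Subfunctor.le_sheafify J _)))
    obtain ⟨x, rfl⟩ := hs
    have e := Subobject.ofLEMk_comp hle
    rw [← e]
    exact ((Subobject.ofLEMk _ i hle).hom.app (op X) x).2
  · intro hs
    have hle : Subfunctor.range A.arrow.hom ⊔ Subfunctor.range B.arrow.hom ≤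
        Subfunctor.range (A ⊔ B).arrow.hom := by
      refine sup_le ?_ ?_
      · have e := Subobject.ofLE_arrow (le_sup_left : A ≤ A ⊔ B)
        rw [← e]
        exact Subfunctor.range_comp_le _ _
      · have e := Subobject.ofLE_arrow (le_sup_right : B ≤ A ⊔ B)
        rw [← e]
        exact Subfunctor.range_comp_le _ _
    have hsh : Presieve.IsSheaf J (Subfunctor.range (A ⊔ B).arrow.hom).toFunctor := by
      have : Mono (A ⊔ B).arrow.hom := inferInstanceAs (Mono ((sheafToPresheaf J _).map _))
      exact Presieve.isSheaf_iso J (asIso (Subfunctor.toRange (A ⊔ B).arrow.hom))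
        ((isSheaf_iff_isSheaf_of_type J _).1 (Subobject.underlying.obj (A ⊔ B)).property)
    exact (Subfunctor.isSheaf_iff _ hF).1 hsh _ s (J.superset_covering (fun Y f h => hle _ h) hs)

theorem mem_range_pullback_truth_iff {F : Sheaf J (Type u)} (p : F ⟶ W.Ω) {X : Dᵒᵖ}
    (s : F.obj.obj X) :
    s ∈ Set.range (((Subobject.pullback p).obj (Subobject.mk W.truth)).arrow.hom.app X) ↔
      IsTrue W (p.hom.app X s) := by
  have h := (Subobject.isPullback p (Subobject.mk W.truth)).flip
  have h' : IsPullback ((Subobject.pullback p).obj (Subobject.mk W.truth)).arrow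
      (Subobject.pullbackπ p (Subobject.mk W.truth) ≫ (Subobject.underlyingIso W.truth).hom)
      p W.truth :=
    h.of_iso (Iso.refl _) (Iso.refl _) (Subobject.underlyingIso W.truth) (Iso.refl _)
      (by simp) (by simp) (by simp) (by simp)
  exact (isTrue_iff_exists_of_isPullback h' s).symm

/-- A disjunction is true if and only if one of the two terms is true locally. -/
theorem isTrue_disj_iff {X : D} (x : (W.Ω ⨯ W.Ω).obj.obj (op X)) :
    IsTrue W ((disj W).hom.app (op X) x) ↔
      ∃ S ∈ J X, ∀ ⦃Y : D⦄ (f : Y ⟶ X), S f →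
        IsTrue W (W.Ω.obj.map f.op ((prod.fst : W.Ω ⨯ W.Ω ⟶ W.Ω).hom.app (op X) x)) ∨
        IsTrue W (W.Ω.obj.map f.op ((prod.snd : W.Ω ⨯ W.Ω ⟶ W.Ω).hom.app (op X) x)) := by
  have key : ∀ ⦃Y : D⦄ (f : Y ⟶ X), Subfunctor.sieveOfSection (Subfunctor.range
      ((Subobject.pullback prod.fst).obj (Subobject.mk W.truth)).arrow.hom ⊔ Subfunctor.range
      ((Subobject.pullback prod.snd).obj (Subobject.mk W.truth)).arrow.hom) x f ↔
      IsTrue W (W.Ω.obj.map f.op ((prod.fst : W.Ω ⨯ W.Ω ⟶ W.Ω).hom.app (op X) x)) ∨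
      IsTrue W (W.Ω.obj.map f.op ((prod.snd : W.Ω ⨯ W.Ω ⟶ W.Ω).hom.app (op X) x)) := by
    intro Y f
    rw [← NatTrans.naturality_apply, ← NatTrans.naturality_apply]
    exact or_congr (mem_range_pullback_truth_iff _ _) (mem_range_pullback_truth_iff _ _)
  refine ((isTrue_χ_iff _ x).trans (mem_range_sup_arrow_iff _ _ x)).trans ?_
  constructor
  · exact fun h => ⟨_, h, fun Y f => (key f).1⟩
  · rintro ⟨S, hS, h⟩
    exact J.superset_covering (fun Y f hf => (key f).2 (h f hf)) hS

/-! ### De Morgan's law in terms of closed sieves -/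

/-- De Morgan's law for `Ω`, unravelled on pairs of truth values. -/
theorem isInternalStone_iff :
    IsInternalStone W ↔ ∀ (X : D) (a b : W.Ω.obj.obj (op X)),
      (∀ ⦃Y : D⦄ (f : Y ⟶ X), IsTrue W (W.Ω.obj.map f.op a) →
        IsTrue W (W.Ω.obj.map f.op b) → (⊥ : Sieve Y) ∈ J Y) →
      ∃ R ∈ J X, ∀ ⦃Y : D⦄ (f : Y ⟶ X), R f →
        IsTrue W ((neg W).hom.app (op Y) (W.Ω.obj.map f.op a)) ∨
        IsTrue W ((neg W).hom.app (op Y) (W.Ω.obj.map f.op b)) := by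
  have hneg : ∀ {X : D} (x : (W.Ω ⨯ W.Ω).obj.obj (op X)),
      IsTrue W ((conj W ≫ neg W).hom.app (op X) x) ↔ ∀ ⦃Y : D⦄ (f : Y ⟶ X),
        IsTrue W (W.Ω.obj.map f.op ((prod.fst : W.Ω ⨯ W.Ω ⟶ W.Ω).hom.app (op X) x)) →
        IsTrue W (W.Ω.obj.map f.op ((prod.snd : W.Ω ⨯ W.Ω ⟶ W.Ω).hom.app (op X) x)) →
        (⊥ : Sieve Y) ∈ J Y := by
    intro X x
    refine (isTrue_neg_iff ((conj W).hom.app (op X) x)).trans (forall₂_congr fun Y f => ?_)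
    rw [← NatTrans.naturality_apply, isTrue_conj_iff, and_imp, NatTrans.naturality_apply,
      NatTrans.naturality_apply]
  have hdisj : ∀ {X : D} (x : (W.Ω ⨯ W.Ω).obj.obj (op X)),
      IsTrue W ((prod.map (neg W) (neg W) ≫ disj W).hom.app (op X) x) ↔
      ∃ R ∈ J X, ∀ ⦃Y : D⦄ (f : Y ⟶ X), R f →
        IsTrue W ((neg W).hom.app (op Y)
          (W.Ω.obj.map f.op ((prod.fst : W.Ω ⨯ W.Ω ⟶ W.Ω).hom.app (op X) x))) ∨
        IsTrue W ((neg W).hom.app (op Y)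
          (W.Ω.obj.map f.op ((prod.snd : W.Ω ⨯ W.Ω ⟶ W.Ω).hom.app (op X) x))) := by
    intro X x
    refine (isTrue_disj_iff ((prod.map (neg W) (neg W)).hom.app (op X) x)).trans ?_
    have h₁ : (prod.fst : W.Ω ⨯ W.Ω ⟶ W.Ω).hom.app (op X)
        ((prod.map (neg W) (neg W)).hom.app (op X) x) =
        (neg W).hom.app (op X) ((prod.fst : W.Ω ⨯ W.Ω ⟶ W.Ω).hom.app (op X) x) :=
      congr_arg (fun k : W.Ω ⨯ W.Ω ⟶ W.Ω => k.hom.app (op X) x) (prod.map_fst (neg W) (neg W))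
    have h₂ : (prod.snd : W.Ω ⨯ W.Ω ⟶ W.Ω).hom.app (op X)
        ((prod.map (neg W) (neg W)).hom.app (op X) x) =
        (neg W).hom.app (op X) ((prod.snd : W.Ω ⨯ W.Ω ⟶ W.Ω).hom.app (op X) x) :=
      congr_arg (fun k : W.Ω ⨯ W.Ω ⟶ W.Ω => k.hom.app (op X) x) (prod.map_snd (neg W) (neg W))
    rw [h₁, h₂]
    simp only [NatTrans.naturality_apply]
  have hent : ∀ {X : Dᵒᵖ} (x : (W.Ω ⨯ W.Ω).obj.obj X),
      IsTrue W ((prod.lift (conj W ≫ neg W) (prod.map (neg W) (neg W) ≫ disj W) ≫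
        conj W).hom.app X x) ↔ IsTrue W ((conj W ≫ neg W).hom.app X x) ∧
        IsTrue W ((prod.map (neg W) (neg W) ≫ disj W).hom.app X x) := by
    intro X x
    refine (isTrue_conj_iff ((prod.lift (conj W ≫ neg W)
      (prod.map (neg W) (neg W) ≫ disj W)).hom.app X x)).trans (and_congr (iff_of_eq ?_)
        (iff_of_eq ?_))
    · exact congr_arg (fun k : W.Ω ⨯ W.Ω ⟶ W.Ω => IsTrue W (k.hom.app X x)) (prod.lift_fst _ _)
    · exact congr_arg (fun k : W.Ω ⨯ W.Ω ⟶ W.Ω => IsTrue W (k.hom.app X x)) (prod.lift_snd _ _)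
  constructor
  · intro h X a b hab
    obtain ⟨x, rfl, rfl⟩ := exists_prod_sections a b
    have h' := (hneg x).2 hab
    have e : IsTrue W ((conj W ≫ neg W).hom.app (op X) x) = _ :=
      congr_arg (fun k : W.Ω ⨯ W.Ω ⟶ W.Ω => IsTrue W (k.hom.app (op X) x)) h.symm
    exact (hdisj x).1 ((hent x).1 (e.mp h')).2
  · intro h
    refine hom_ext_of_isTrue fun X x => (hent x).trans (and_iff_left_of_imp fun hx => ?_)
    exact (hdisj (X := X.unop) x).2 (h _ _ _ ((hneg (X := X.unop) x).1 hx))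

/-- `Ω` satisfies De Morgan's law if and only if, for any closed sieves `S` and `T` on an object
`X` whose intersection consists of arrows from empty objects (those covered by the empty sieve),
`X` is covered by arrows `f` such that `f^* S` or `f^* T` consists of arrows from empty objects. -/
theorem isInternalStone_iff_isClosed :
    IsInternalStone W ↔ ∀ (X : D) (S T : Sieve X), J.IsClosed S → J.IsClosed T →
      (∀ ⦃Y : D⦄ (f : Y ⟶ X), S f → T f → (⊥ : Sieve Y) ∈ J Y) →
      ∃ R ∈ J X, ∀ ⦃Y : D⦄ (f : Y ⟶ X), R f →
        (∀ ⦃Z : D⦄ (g : Z ⟶ Y), S (g ≫ f) → (⊥ : Sieve Z) ∈ J Z) ∨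
        (∀ ⦃Z : D⦄ (g : Z ⟶ Y), T (g ≫ f) → (⊥ : Sieve Z) ∈ J Z) := by
  have hneg : ∀ {X Y : D} (a : W.Ω.obj.obj (op X)) (f : Y ⟶ X),
      IsTrue W ((neg W).hom.app (op Y) (W.Ω.obj.map f.op a)) ↔
        ∀ ⦃Z : D⦄ (g : Z ⟶ Y), truthSieve W a (g ≫ f) → (⊥ : Sieve Z) ∈ J Z := by
    intro X Y a f
    simp only [isTrue_neg_iff, truthSieve_apply, op_comp, Functor.map_comp_apply]
  rw [isInternalStone_iff]
  simp only [hneg, ← truthSieve_apply]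
  constructor
  · intro h X S T hS hT
    obtain ⟨a, rfl⟩ := exists_truthSieve_eq (W := W) hS
    obtain ⟨b, rfl⟩ := exists_truthSieve_eq (W := W) hT
    exact h X a b
  · exact fun h X a b => h X _ _ (isClosed_truthSieve a) (isClosed_truthSieve b)

/-- The closed-sieve criterion for a topos of sheaves: it does not depend on the subobject
classifier, and the sheaf of closed sieves is one. -/
theorem isDeMorganTopos_sheaf_iff :
    IsDeMorganTopos (Sheaf J (Type u)) ↔
      ∀ (X : D) (S T : Sieve X), J.IsClosed S → J.IsClosed T →
      (∀ ⦃Y : D⦄ (f : Y ⟶ X), S f → T f → (⊥ : Sieve Y) ∈ J Y) →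
      ∃ R ∈ J X, ∀ ⦃Y : D⦄ (f : Y ⟶ X), R f →
        (∀ ⦃Z : D⦄ (g : Z ⟶ Y), S (g ≫ f) → (⊥ : Sieve Z) ∈ J Z) ∨
        (∀ ⦃Z : D⦄ (g : Z ⟶ Y), T (g ≫ f) → (⊥ : Sieve Z) ∈ J Z) :=
  ⟨fun ⟨_, hW⟩ => isInternalStone_iff_isClosed.1 hW,
    fun h => ⟨Sheaf.classifier J, isInternalStone_iff_isClosed.2 h⟩⟩

end SubobjectClassifier

/-! ### Closed sieves for the existential topology -/

namespace InternalLocale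

variable {C : Type u} [SmallCategory C] {J : GrothendieckTopology C} {L : InternalLocale J}

/-- The sieve on `(c, x)` given by `z ∈ L(c)`: the arrows `f : (d, y) ⟶ (c, x)` with
`y ≤ L(f)(z)`. It is generated by `(c, z ∧ x) ⟶ (c, x)`. -/
def below {X : L.Total} (z : L.frm.obj (op X.base)) : Sieve X where
  arrows Y f := Y.fib ≤ L.frm.map f.base.op z
  downward_closed := by
    intro Y Z f hf g
    change Z.fib ≤ L.frm.map (g.base ≫ f.base).op z
    rw [op_comp, Functor.map_comp]
    exact (Total.Hom.le g).trans (OrderHomClass.mono (L.frm.map g.base.op).hom hf)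

theorem below_apply_iff {X Y : L.Total} (z : L.frm.obj (op X.base)) (f : Y ⟶ X) :
    below z f ↔ L.ex f.base Y.fib ≤ z :=
  (L.gc f.base _ _).symm

theorem ex_id {c : C} (x : L.frm.obj (op c)) : L.ex (𝟙 c) x = x :=
  eq_of_forall_ge_iff fun z => by
    rw [(L.gc _).le_iff_le, op_id, CategoryTheory.Functor.map_id]
    rfl

/-- The object `(c, z ∧ x)`, for `X = (c, x)`. -/
def restrict (X : L.Total) (z : L.frm.obj (op X.base)) : L.Total :=
  ⟨X.base, z ⊓ X.fib⟩

/-- The morphism `(c, z ∧ x) ⟶ (c, x)` over the identity of `c`. -/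
def restrictι (X : L.Total) (z : L.frm.obj (op X.base)) : restrict X z ⟶ X :=
  ⟨𝟙 X.base, inf_le_right.trans ((L.gc (𝟙 X.base)).le_iff_le.1 (ex_id X.fib).le)⟩

/-- The factorization through `(c, z ∧ x)` of an arrow of the sieve `below z` on `(c, x)`. -/
def restrictLift {X Y : L.Total} {z : L.frm.obj (op X.base)} (f : Y ⟶ X) (hf : below z f) :
    Y ⟶ restrict X z :=
  ⟨f.base, (le_inf hf (Total.Hom.le f)).trans_eq (map_inf (L.frm.map f.base.op).hom z X.fib).symm⟩

theorem restrictLift_comp_restrictι {X Y : L.Total} {z : L.frm.obj (op X.base)} (f : Y ⟶ X)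
    (hf : below z f) : restrictLift f hf ≫ restrictι X z = f :=
  Total.Hom.ext (Category.comp_id (X := Y.base) f.base)

theorem ex_restrictι (X : L.Total) (z : L.frm.obj (op X.base)) :
    L.ex (restrictι X z).base (restrict X z).fib = z ⊓ X.fib :=
  ex_id _

theorem below_restrictι (X : L.Total) (z : L.frm.obj (op X.base)) : below z (restrictι X z) :=
  (below_apply_iff z _).2 ((ex_restrictι X z).trans_le inf_le_left)

theorem pullback_below {X Y : L.Total} (z : L.frm.obj (op X.base)) (f : Y ⟶ X) :
    (below z).pullback f = below (L.frm.map f.base.op z) := by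
  ext Z g
  change Z.fib ≤ L.frm.map (g.base ≫ f.base).op z ↔ _
  rw [op_comp, Functor.map_comp]
  rfl

/-- Frobenius reciprocity for negations: `y` is disjoint from `L(f)(z)` if and only if `∃_f(y)` is
disjoint from `z`. -/
theorem le_compl_map_iff {d c : C} (f : d ⟶ c) (y : L.frm.obj (op d)) (z : L.frm.obj (op c)) :
    y ≤ (L.frm.map f.op z)ᶜ ↔ L.ex f y ≤ zᶜ := by
  rw [le_compl_iff_disjoint_left, disjoint_iff, le_compl_iff_disjoint_right, disjoint_iff,
    ← L.frobenius, ← le_bot_iff, ← le_bot_iff, (L.gc f).le_iff_le, map_bot]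

variable [HasPullbacks C]

theorem bot_mem_existentialTopology_iff {X : L.Total} :
    (⊥ : Sieve X) ∈ L.existentialTopology X ↔ X.fib = ⊥ := by
  refine (existentiallyCovers_iff _).trans ⟨fun h => ?_, fun h z _ => h ▸ bot_le⟩
  exact le_bot_iff.1 (h ⊥ fun Y f hf => False.elim hf)

theorem isClosed_below {X : L.Total} (z : L.frm.obj (op X.base)) :
    L.existentialTopology.IsClosed (below (X := X) z) := by
  intro Y f hf
  refine (existentiallyCovers_iff _).1 hf _ fun Z g hg => ?_
  rw [← (L.gc f.base).le_iff_le, ← ex_comp]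
  exact (below_apply_iff z (g ≫ f)).1 hg

/-- Every closed sieve on `(c, x)` is of the form `below z`: for `z` the supremum of the `∃_f(y)`,
the sieve covers `(c, z)`, hence contains `(c, z) ⟶ (c, x)`. -/
theorem exists_below_eq {X : L.Total} {S : Sieve X} (hS : L.existentialTopology.IsClosed S) :
    ∃ z : L.frm.obj (op X.base), below z = S := by
  let z : L.frm.obj (op X.base) :=
    ⨆ i : Σ Y : L.Total, {f : Y ⟶ X // S f}, L.ex i.2.1.base i.1.fib
  have hz : ∀ {Y : L.Total} (f : Y ⟶ X), S f → below z f := fun {Y} f hf =>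
    (below_apply_iff z f).2 <|
      le_iSup (fun i : Σ Y : L.Total, {f : Y ⟶ X // S f} => L.ex i.2.1.base i.1.fib) ⟨Y, f, hf⟩
  have hι : S (restrictι X z) := by
    refine hS _ ((existentiallyCovers_iff _).2 fun w hw => inf_le_left.trans (iSup_le fun k => ?_))
    refine hw (restrictLift k.2.1 (hz k.2.1 k.2.2)) ?_
    rw [Sieve.pullback_apply, restrictLift_comp_restrictι]
    exact k.2.2
  refine ⟨z, le_antisymm (fun Y f hf => ?_) fun Y f hf => hz f hf⟩
  rw [← restrictLift_comp_restrictι f hf]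
  exact S.downward_closed hι _

theorem forall_below_imp_bot_mem_iff (X : L.Total) (z : L.frm.obj (op X.base)) :
    (∀ ⦃Y : L.Total⦄ (f : Y ⟶ X), below z f → (⊥ : Sieve Y) ∈ L.existentialTopology Y) ↔
      X.fib ≤ zᶜ := by
  rw [le_compl_iff_disjoint_left, disjoint_iff]
  simp only [bot_mem_existentialTopology_iff]
  refine ⟨fun h => h _ (below_restrictι X z), fun h Y f hf => ?_⟩
  have hle := Total.Hom.le (restrictLift f hf)
  change Y.fib ≤ L.frm.map f.base.op (z ⊓ X.fib) at hle
  rwa [h, map_bot, le_bot_iff] at hle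

theorem forall_below_comp_imp_bot_mem_iff {X Y : L.Total} (z : L.frm.obj (op X.base))
    (f : Y ⟶ X) :
    (∀ ⦃Z : L.Total⦄ (g : Z ⟶ Y), below z (g ≫ f) → (⊥ : Sieve Z) ∈ L.existentialTopology Z) ↔
      L.ex f.base Y.fib ≤ zᶜ := by
  rw [← le_compl_map_iff, ← forall_below_imp_bot_mem_iff, ← pullback_below]
  rfl

end InternalLocale

/-! ### De Morgan's law for internal sheaves -/

open InternalLocale in
theorem mainTheorem8 {C : Type u} [SmallCategory C] [HasFiniteLimits C]
    (J : GrothendieckTopology C) (L : InternalLocale J) :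
    IsDeMorganTopos L.InternalSheaves ↔ L.IsStone := by
  refine SubobjectClassifier.isDeMorganTopos_sheaf_iff.trans ?_
  have hdisj : ∀ {X : L.Total} (x y : L.frm.obj (op X.base)),
      (∀ ⦃Y : L.Total⦄ (f : Y ⟶ X), below x f → below y f →
        (⊥ : Sieve Y) ∈ L.existentialTopology Y) ↔ X.fib ≤ (x ⊓ y)ᶜ := by
    intro X x y
    simp only [← forall_below_imp_bot_mem_iff, below_apply_iff, le_inf_iff, and_imp]
  constructor
  · intro h c x y
    -- On `(c, ¬ (x ∧ y))` the sieves `below x` and `below y` have an empty intersection.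
    let X : L.Total := ⟨c, (x ⊓ y)ᶜ⟩
    obtain ⟨R, hR, hR'⟩ := h X (below x) (below y) (isClosed_below _) (isClosed_below _)
      ((hdisj (X := X) x y).2 le_rfl)
    refine (existentiallyCovers_iff R).1 hR _ fun Y f hf => ?_
    exact ((hR' f hf).imp (forall_below_comp_imp_bot_mem_iff _ f).1
      (forall_below_comp_imp_bot_mem_iff _ f).1).elim le_sup_of_le_left le_sup_of_le_right
  · intro h X S T hS hT hST
    obtain ⟨x, rfl⟩ := exists_below_eq hS
    obtain ⟨y, rfl⟩ := exists_below_eq hT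
    refine ⟨below xᶜ ⊔ below yᶜ, (existentiallyCovers_iff _).2 fun z hz => ?_, ?_⟩
    -- `(c, x₀)` is covered by the inclusions of `(c, ¬ x ∧ x₀)` and `(c, ¬ y ∧ x₀)`.
    · have hx := hz _ (Or.inl (below_restrictι X xᶜ))
      have hy := hz _ (Or.inr (below_restrictι X yᶜ))
      rw [ex_restrictι] at hx hy
      calc X.fib ≤ (xᶜ ⊔ yᶜ) ⊓ X.fib := le_inf (((hdisj x y).1 hST).trans (h _ x y)) le_rfl
        _ = xᶜ ⊓ X.fib ⊔ yᶜ ⊓ X.fib := inf_sup_right _ _ _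
        _ ≤ z := sup_le hx hy
    · rintro Y f (hf | hf)
      · exact Or.inl ((forall_below_comp_imp_bot_mem_iff x f).2 ((below_apply_iff _ f).1 hf))
      · exact Or.inr ((forall_below_comp_imp_bot_mem_iff y f).2 ((below_apply_iff _ f).1 hf))
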